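/- Let $G$ be a group and let $G\cong F/R$ be a presentation of $G$, where $F=F(S)$ is the free group on a set $S$ and $R$ is a normal subgroup of $F$ (equivalently, $R=\ker\pi$ for a surjective homomorphism $\pi:F\to G$). Let $R_{ab}=R/[R,R]$ be the relation module, i.e. the abelianization of $R$ with the $G$-action induced by conjugation of $F$ on $R$. Tensor products are taken over $\mathbb{Z}$ and carry the diagonal $G$-action, and $R_{ab}^{\otimes 0}=\mathbb{Z}$ is the trivial $G$-module. Then for every $n\ge 1$ there are isomorphisms $$H_{2n}(G,M)\;\simeq\;H_{2}\bigl(G,\,M\otimes R_{ab}^{\otimes (n-1)}\bigr)\qquad\text{and}\qquad H_{2n+1}(G,M)\;\simeq\;H_{1}\bigl(G,\,M\otimes R_{ab}^{\otimes n}\bigr),$$ natural in the $\mathbb{Z}G$-module $M$. -/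

import Mathlib

universe u

open CategoryTheory MonoidalCategory

namespace RelationModule

/-- The coefficient ring `ℤ`, placed in the universe of the group, because Mathlib's group homology
asks for the ring and the group to live in the same universe. Thus `Rep (Zu.{u}) G` is the category
of `ℤG`-modules. -/
abbrev Zu : Type u := ULift.{u} ℤ

variable {F G : Type u} [Group F] [Group G]

/-- The abelianization `R_ab = R/[R,R]` of `R = ker π`, written additively. -/
abbrev RAb (π : F →* G) : Type u := Additive (Abelianization π.ker)

/-- The class of `r ∈ R` in `R_ab`. -/
def cls (π : F →* G) (r : π.ker) : RAb π := Additive.ofMul (Abelianization.of r)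

/-- The endomorphism of `R_ab` induced by conjugation by `f`: `r[R,R] ↦ (f r f⁻¹)[R,R]`. -/
def conjEnd (π : F →* G) (f : F) : RAb π →ₗ[Zu.{u}] RAb π where
  toFun := MonoidHom.toAdditive
    (Abelianization.map (MulAut.conjNormal (H := π.ker) f).toMonoidHom)
  map_add' := map_add _
  map_smul' c x := map_zsmul _ c.down x

theorem conjEnd_cls (π : F →* G) (f : F) (r : π.ker) :
    conjEnd π f (cls π r) = cls π (MulAut.conjNormal f r) := rfl

theorem end_ext (π : F →* G) {a b : RAb π →ₗ[Zu.{u}] RAb π}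
    (h : ∀ r : π.ker, a (cls π r) = b (cls π r)) : a = b := by
  refine LinearMap.ext fun x => ?_
  obtain ⟨r, hr⟩ := QuotientGroup.mk_surjective (Additive.toMul x)
  have hx : x = cls π r := hr.symm
  rw [hx]
  exact h r

/-- The conjugation action of `F` on `R_ab`. -/
def conjRep (π : F →* G) : Representation Zu.{u} F (RAb π) where
  toFun := conjEnd π
  map_one' := end_ext π fun r => by
    rw [conjEnd_cls, map_one]
    rfl
  map_mul' f g := end_ext π fun r => by
    rw [Module.End.mul_apply, conjEnd_cls, conjEnd_cls, conjEnd_cls, map_mul]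
    rfl

/-- The conjugation action on `R_ab` is trivial when restricted to `R`. -/
instance conjRep_isTrivial (π : F →* G) :
    Representation.IsTrivial ((conjRep π).comp π.ker.subtype) where
  out s := end_ext π fun r => by
    change conjEnd π (s : F) (cls π r) = cls π r
    rw [conjEnd_cls, MulAut.conjNormal_val, MulAut.conj_apply]
    have h : Abelianization.of (s * r * s⁻¹) = Abelianization.of r := by
      rw [map_mul, map_mul, map_inv, mul_comm (Abelianization.of s), mul_inv_cancel_right]
    exact congrArg Additive.ofMul h

/-- The relation module of a presentation `π : F ↠ G` with `R = ker π`: the abelian group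
`R_ab = R/[R,R]`, with the action of `G ≃ F/R` induced by conjugation. -/
noncomputable def relationModule (π : F →* G) (hπ : Function.Surjective π) : Rep.{u} Zu.{u} G :=
  Rep.of (((conjRep π).ofQuotient π.ker).comp
    (QuotientGroup.quotientKerEquivOfSurjective π hπ).symm.toMonoidHom)

/-- `π f` acts on `R_ab` by `r[R,R] ↦ (f r f⁻¹)[R,R]`. -/
theorem relationModule_apply (π : F →* G) (hπ : Function.Surjective π) (f : F) (r : π.ker) :
    (relationModule π hπ).ρ (π f) (cls π r) = cls π (MulAut.conjNormal f r) := by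
  have h : (QuotientGroup.quotientKerEquivOfSurjective π hπ).symm (π f) =
      (QuotientGroup.mk f : F ⧸ π.ker) := by
    rw [MulEquiv.symm_apply_eq]
    rfl
  change (conjRep π).ofQuotient π.ker
    ((QuotientGroup.quotientKerEquivOfSurjective π hπ).symm (π f)) (cls π r) = _
  rw [h]
  rfl

/-- The tensor power `A^{⊗n}` over `ℤ`, with diagonal `G`-action; `A^{⊗0}` is the trivial
module `ℤ`. -/
noncomputable def tensorPow (A : Rep.{u} Zu.{u} G) : ℕ → Rep.{u} Zu.{u} G
  | 0 => 𝟙_ (Rep.{u} Zu.{u} G)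
  | n + 1 => tensorPow A n ⊗ A

end RelationModule

/-! Write I for the augmentation ideal. The sequences I → ℤG → ℤ and R_ab → ℤG^(S) → I are short
exact and split over ℤ, so they stay exact after M ⊗ -. Their middle terms then become acyclic in
positive degrees, and two connecting maps give H_{i+2}(G, M) ≅ H_{i+1}(G, M ⊗ I) ≅ H_i(G, M ⊗ R_ab)
for i ≥ 1, naturally in M (`relShift`). Iterating absorbs one factor R_ab per two degrees. Exactness
of the second sequence is proved by Fox calculus: the Fox derivative embeds R_ab, and a
set-theoretic section of π yields an explicit ℤ-linear splitting (`relRetraction`, `relSection`). -/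

namespace groupHomology

variable {k G : Type u} [CommRing k] [Group G]

open Limits

/-! ### Acyclic coefficients and dimension shifting -/

/-- Modules induced from the trivial subgroup are acyclic for group homology. -/
theorem isZero_ind_bot (B : Rep.{u} k (⊥ : Subgroup G)) (n : ℕ) :
    IsZero (groupHomology (Rep.ind (⊥ : Subgroup G).subtype B) (n + 1)) := by
  classical
  -- Shapiro's lemma reduces to the trivial group.
  exact (isZero_groupHomology_succ_of_subsingleton B n).of_iso (indIso ⊥ B (n + 1))

theorem isZero_of_retract {A B : Rep.{u} k G} (r : Retract A B) (n : ℕ)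
    (h : IsZero (groupHomology B n)) : IsZero (groupHomology A n) := by
  have := (r.map (functor k G n))
  rw [IsZero.iff_id_eq_zero]
  have e := this.retract
  have h' : IsZero ((functor k G n).obj B) := h
  rw [h'.eq_of_tgt this.i 0, zero_comp] at e
  exact e.symm

/-- The morphism `M ⊗ k[G]^(α) ⟶ N` determined by linear maps `M → N` indexed by `α`. -/
noncomputable def tensorFreeHom (M N : Rep.{u} k G) (α : Type u) (f : α → M →ₗ[k] N) :
    M ⊗ Rep.free k G α ⟶ N :=
  (Rep.tensorHomEquiv M (Rep.free k G α) N).symm (Rep.freeLift k G (A := Rep.of (Representation.linHom M.ρ N.ρ)) f)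

theorem tensorFreeHom_tmul (M N : Rep.{u} k G) (α : Type u) (f : α → M →ₗ[k] N) (m : M) (a : α) :
    (tensorFreeHom M N α f).hom (TensorProduct.tmul k m (Finsupp.single a (.single 1 1))) =
      f a m := by
  have h : (Rep.freeLift k G (A := Rep.of (Representation.linHom M.ρ N.ρ)) f).hom
      (Finsupp.single a (.single 1 1)) = f a := by
    refine (Representation.freeLift_single_single _ a 1 1 f).trans ?_
    rw [map_one, one_smul]
    rfl
  exact LinearMap.congr_fun h m

theorem tensorFree_hom_ext {M N : Rep.{u} k G} {α : Type u} {f g : M ⊗ Rep.free k G α ⟶ N}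
    (h : ∀ (m : M) (a : α), f.hom (TensorProduct.tmul k m (Finsupp.single a (.single 1 1))) =
      g.hom (TensorProduct.tmul k m (Finsupp.single a (.single 1 1)))) : f = g := by
  refine (Rep.tensorHomEquiv M (Rep.free k G α) N).injective (Rep.free_ext _ _ _ _ _ fun a => ?_)
  exact LinearMap.ext fun m => h m a

/-- `M ⊗ k[G]^(α)` is a retract of a module induced from the trivial subgroup. -/
noncomputable def tensorFreeRetract (M : Rep.{u} k G) (α : Type u) :
    Retract (M ⊗ Rep.free k G α) (Rep.ind (⊥ : Subgroup G).subtype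
      (Rep.res (⊥ : Subgroup G).subtype (M ⊗ Rep.free k G α))) where
  -- The map r is the counit of induction and restriction; the vectors m ⊗ e_a generate the source,
  -- so r ∘ i is checked on them.
  i := tensorFreeHom _ _ _ fun a => Representation.IndV.mk _ _ 1 ∘ₗ
    (TensorProduct.mk k M (Rep.free k G α)).flip (Finsupp.single a (.single 1 1))
  r := (Rep.indResHomEquiv _ _ _).symm (𝟙 _)
  retract := by
    refine tensorFree_hom_ext fun m a => ?_
    rw [Rep.hom_comp, Representation.IntertwiningMap.comp_apply, tensorFreeHom_tmul]
    have := (Rep.indResHomEquiv (⊥ : Subgroup G).subtype _ (M ⊗ Rep.free k G α)).right_inv (𝟙 _)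
    exact congr(($this).hom (TensorProduct.tmul k m (Finsupp.single a (.single 1 1))))

theorem isZero_tensor_free (M : Rep.{u} k G) (α : Type u) (n : ℕ) :
    IsZero (groupHomology (M ⊗ Rep.free k G α) (n + 1)) :=
  isZero_of_retract (tensorFreeRetract M α) _ (isZero_ind_bot _ n)

/-- `k[G]` is a retract of the free module on one generator. -/
noncomputable def leftRegularRetract : Retract (Rep.leftRegular k G) (Rep.free k G PUnit.{u + 1}) where
  i := Rep.leftRegularHom _ (Finsupp.single PUnit.unit (.single 1 1))
  r := Rep.freeLift k G (A := Rep.leftRegular k G) fun _ => MonoidAlgebra.single 1 1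
  retract := by
    apply (Rep.leftRegularHomEquiv _).injective
    change (Rep.freeLift k G (A := Rep.leftRegular k G) fun _ => MonoidAlgebra.single 1 1).hom
      ((Rep.leftRegularHom _ _).hom (MonoidAlgebra.single 1 1)) = MonoidAlgebra.single 1 1
    simp

theorem isZero_tensor_leftRegular (M : Rep.{u} k G) (n : ℕ) :
    IsZero (groupHomology (M ⊗ Rep.leftRegular k G) (n + 1)) :=
  isZero_of_retract (leftRegularRetract.map (tensorLeft M)) _ (isZero_tensor_free M _ n)

/-- Tensoring a `k`-split short complex of representations gives a short exact sequence. -/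
theorem shortExact_map_tensorLeft {X : ShortComplex (Rep.{u} k G)} (r : X.X₂ →ₗ[k] X.X₁)
    (s : X.X₃ →ₗ[k] X.X₂) (hr : r ∘ₗ X.f.hom.toLinearMap = LinearMap.id)
    (hs : X.g.hom.toLinearMap ∘ₗ s = LinearMap.id)
    (hrs : X.f.hom.toLinearMap ∘ₗ r + s ∘ₗ X.g.hom.toLinearMap = LinearMap.id)
    (M : Rep.{u} k G) : (X.map (tensorLeft M)).ShortExact := by
  have hr' : r.lTensor M ∘ₗ X.f.hom.toLinearMap.lTensor M = LinearMap.id := by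
    rw [← LinearMap.lTensor_comp, hr, LinearMap.lTensor_id]
  have hs' : X.g.hom.toLinearMap.lTensor M ∘ₗ s.lTensor M = LinearMap.id := by
    rw [← LinearMap.lTensor_comp, hs, LinearMap.lTensor_id]
  have hrs' : X.f.hom.toLinearMap.lTensor M ∘ₗ r.lTensor M +
      s.lTensor M ∘ₗ X.g.hom.toLinearMap.lTensor M = LinearMap.id := by
    rw [← LinearMap.lTensor_comp, ← LinearMap.lTensor_comp, ← LinearMap.lTensor_add, hrs,
      LinearMap.lTensor_id]
  have hf : Mono (X.map (tensorLeft M)).f := (Rep.mono_iff_injective _).2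
    (Function.LeftInverse.injective fun x => LinearMap.congr_fun hr' x)
  have hg : Epi (X.map (tensorLeft M)).g := (Rep.epi_iff_surjective _).2
    (Function.RightInverse.surjective fun x => LinearMap.congr_fun hs' x)
  refine .mk' ?_ hf hg
  -- Exactness is seen on underlying modules, so the splitting need not be equivariant.
  refine (ShortComplex.exact_map_iff_of_faithful _ (forget₂ (Rep.{u} k G) (ModuleCat k))).1 ?_
  rw [ShortComplex.moduleCat_exact_iff]
  intro x hx
  refine ⟨r.lTensor M x, ?_⟩
  have hx' : X.g.hom.toLinearMap.lTensor M x = 0 := hx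
  have h : X.f.hom.toLinearMap.lTensor M (r.lTensor M x) +
      s.lTensor M (X.g.hom.toLinearMap.lTensor M x) = x := LinearMap.congr_fun hrs' x
  rw [hx', map_zero, add_zero] at h
  exact h

/-- Natural dimension shifting along a short exact sequence with acyclic middle term. -/
noncomputable def dimensionShift {X : ShortComplex (Rep.{u} k G)}
    (hX : ∀ M : Rep.{u} k G, (X.map (tensorLeft M)).ShortExact)
    (h₂ : ∀ (M : Rep.{u} k G) (n : ℕ), IsZero (groupHomology (M ⊗ X.X₂) (n + 1))) (n : ℕ) :
    tensorRight X.X₃ ⋙ functor k G (n + 1 + 1) ≅ tensorRight X.X₁ ⋙ functor k G (n + 1) :=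
  NatIso.ofComponents
    (fun M =>
      @asIso _ _ _ _ (δ (hX M) (n + 1 + 1) (n + 1) rfl)
        -- The middle term must vanish in both degrees n + 2 and n + 1, hence targets of degree at
        -- least 1.
        (isIso_δ_of_isZero (hX M) (n + 1) (h₂ M (n + 1)) (h₂ M n)))
    fun {M N} f =>
      (HomologicalComplex.HomologySequence.δ_naturality
        ((chainsFunctor k G).mapShortComplex.map (X.mapNatTrans ((curriedTensor _).map f)))
        (map_chainsFunctor_shortExact (hX M)) (map_chainsFunctor_shortExact (hX N)) _ _ rfl).symm

end groupHomology

/-! ### Fox calculus -/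

namespace RelationModule

variable {G S : Type u} [Group G] (π : FreeGroup S →* G)

/-- The free `ℤG`-module on the generators. -/
noncomputable abbrev relFree (G S : Type u) [Group G] : Rep.{u} Zu.{u} G := Rep.free Zu.{u} G S

/-- The basis element of `ℤG^(S)` attached to a generator. -/
noncomputable abbrev basisVec (G : Type u) [Group G] {S : Type u} (x : S) : relFree G S :=
  Finsupp.single x (MonoidAlgebra.single 1 1)

/-- The action of the free group on `ℤG^(S)` by affine maps, a generator `x` acting as
`v ↦ x • v + e_x`. -/
noncomputable def affineAction : FreeGroup S →* Equiv.Perm (relFree G S) :=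
  FreeGroup.lift fun x =>
    { toFun v := (relFree G S).ρ (π (FreeGroup.of x)) v + basisVec G x
      invFun v := (relFree G S).ρ (π (FreeGroup.of x))⁻¹ (v - basisVec G x)
      left_inv v := by
        dsimp only
        rw [add_sub_cancel_right, ← Module.End.mul_apply, ← map_mul, inv_mul_cancel, map_one,
          Module.End.one_apply]
      right_inv v := by
        dsimp only
        rw [← Module.End.mul_apply, ← map_mul, mul_inv_cancel, map_one, Module.End.one_apply,
          sub_add_cancel] }

/-- The total Fox derivative `w ↦ ∑ₓ (∂w/∂x) eₓ`. -/
noncomputable def foxDeriv (w : FreeGroup S) : relFree G S := affineAction π w 0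

theorem affineAction_of (x : S) (v : relFree G S) :
    affineAction π (FreeGroup.of x) v = (relFree G S).ρ (π (FreeGroup.of x)) v + basisVec G x := by
  rw [affineAction, FreeGroup.lift_apply_of]
  rfl

/-- The affine map of w has linear part π w, so its translation part is a crossed homomorphism. -/
theorem affineAction_apply (w : FreeGroup S) (v : relFree G S) :
    affineAction π w v = (relFree G S).ρ (π w) v + foxDeriv π w := by
  have key : ∀ x : S, ∀ v, affineAction π (FreeGroup.of x) v =
      (relFree G S).ρ (π (FreeGroup.of x)) v + foxDeriv π (FreeGroup.of x) := fun x v => by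
    rw [foxDeriv, affineAction_of, affineAction_of, map_zero, zero_add]
  induction w using FreeGroup.induction_on generalizing v with
  | C1 => simp [foxDeriv]
  | of x => exact key x v
  | inv_of x _ =>
    have h : ∀ v, affineAction π (FreeGroup.of x)⁻¹ v =
        (relFree G S).ρ (π (FreeGroup.of x))⁻¹ (v - basisVec G x) := fun v => by
      rw [map_inv, Equiv.Perm.inv_eq_iff_eq, affineAction_of, ← Module.End.mul_apply, ← map_mul,
        mul_inv_cancel, map_one, Module.End.one_apply, sub_add_cancel]
    rw [foxDeriv, h, h, map_inv π, zero_sub, map_sub, map_neg, sub_eq_add_neg]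
  | mul a b ha hb =>
    rw [foxDeriv, map_mul, Equiv.Perm.mul_apply, Equiv.Perm.mul_apply, hb, ha, hb 0, ha, map_zero,
      zero_add, map_add, map_mul, map_mul, Module.End.mul_apply, add_assoc]

@[simp]
theorem foxDeriv_one : foxDeriv π 1 = 0 := by simp [foxDeriv]

theorem foxDeriv_of (x : S) : foxDeriv π (FreeGroup.of x) = basisVec G x := by
  rw [foxDeriv, affineAction_of, map_zero, zero_add]

theorem foxDeriv_mul (a b : FreeGroup S) :
    foxDeriv π (a * b) = foxDeriv π a + (relFree G S).ρ (π a) (foxDeriv π b) := by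
  rw [foxDeriv, map_mul, Equiv.Perm.mul_apply, affineAction_apply, add_comm]
  rfl

theorem foxDeriv_mul_inv (a b : FreeGroup S) (h : π a = π b) :
    foxDeriv π (a * b⁻¹) = foxDeriv π a - foxDeriv π b := by
  have := foxDeriv_mul π (a * b⁻¹) b
  rw [inv_mul_cancel_right, map_mul, map_inv, h, mul_inv_cancel, map_one,
    Module.End.one_apply] at this
  rw [this, add_sub_cancel_right]

/-- An additive map from `R_ab` is `ℤ`-linear, with `ℤ` in any universe. -/
def liftRAb {V : Type u} [AddCommGroup V] [Module Zu.{u} V] (D : π.ker → V)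
    (hD : ∀ r s, D (r * s) = D r + D s) : RAb π →ₗ[Zu.{u}] V :=
  let φ : π.ker →* Multiplicative V := MonoidHom.mk' (fun r => Multiplicative.ofAdd (D r)) hD
  let ψ : RAb π →+ V := MonoidHom.toAdditiveLeft (Abelianization.lift φ)
  { ψ with
    map_smul' := fun c x => by
      have hc : LinearMap.toSpanSingleton Zu.{u} V (ψ x) c = c.down • ψ x := by
        have h : c = c.down • (1 : Zu.{u}) := ULift.ext _ _ (mul_one c.down).symm
        conv_lhs => rw [h]
        rw [map_zsmul, LinearMap.toSpanSingleton_apply_one]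
      exact (map_zsmul ψ c.down x).trans hc.symm }

theorem liftRAb_cls {V : Type u} [AddCommGroup V] [Module Zu.{u} V] (D : π.ker → V)
    (hD : ∀ r s, D (r * s) = D r + D s) (r : π.ker) : liftRAb π D hD (cls π r) = D r := by
  rfl

theorem linearMap_ext_cls {V : Type u} [AddCommGroup V] [Module Zu.{u} V]
    {a b : RAb π →ₗ[Zu.{u}] V} (h : ∀ r : π.ker, a (cls π r) = b (cls π r)) : a = b := by
  refine LinearMap.ext fun x => ?_
  obtain ⟨r, hr⟩ := QuotientGroup.mk_surjective (Additive.toMul x)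
  have hx : x = cls π r := hr.symm
  rw [hx]
  exact h r

theorem cls_mul (r s : π.ker) : cls π (r * s) = cls π r + cls π s := rfl

variable (hπ : Function.Surjective π)

/-- The embedding `R_ab ⟶ ℤG^(S)` induced by the Fox derivative. -/
noncomputable def relEmbedding : relationModule π hπ ⟶ relFree G S :=
  Rep.ofHom
    { toLinearMap := liftRAb π (fun r => foxDeriv π r) fun r s => by
        rw [Subgroup.coe_mul, foxDeriv_mul, r.2, map_one, Module.End.one_apply]
      isIntertwining' := fun g => by
        obtain ⟨f, rfl⟩ := hπ g
        refine linearMap_ext_cls π fun r => ?_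
        rw [LinearMap.comp_apply, LinearMap.comp_apply]
        erw [relationModule_apply π hπ f r]
        -- D(f r f⁻¹) = D(f r) - D(f) = π(f) D(r), because π(f r) = π(f).
        rw [liftRAb_cls, liftRAb_cls, MulAut.conjNormal_apply, foxDeriv_mul_inv,
          foxDeriv_mul, add_sub_cancel_left]
        rw [map_mul, r.2, mul_one] }

/-- The map `ℤG^(S) ⟶ ℤG`, `eₓ ↦ x - 1`. -/
noncomputable def relBoundary : relFree G S ⟶ Rep.leftRegular Zu.{u} G :=
  Rep.freeLift Zu.{u} G (A := Rep.leftRegular Zu.{u} G)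
    fun x => MonoidAlgebra.single (π (FreeGroup.of x)) 1 - MonoidAlgebra.single 1 1

/-- The augmentation `ℤG ⟶ ℤ`. -/
noncomputable def augmentation (G : Type u) [Group G] :
    Rep.leftRegular Zu.{u} G ⟶ 𝟙_ (Rep.{u} Zu.{u} G) :=
  Rep.leftRegularHom (Rep.trivial Zu.{u} G Zu.{u}) (1 : Zu.{u})

theorem relBoundary_single (x : S) (g : G) :
    (relBoundary π).hom (Finsupp.single x (MonoidAlgebra.single g 1)) =
      MonoidAlgebra.single (g * π (FreeGroup.of x)) 1 - MonoidAlgebra.single g 1 := by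
  simp [relBoundary]

theorem augmentation_single (g : G) :
    (augmentation G).hom (MonoidAlgebra.single g 1) = (1 : Zu.{u}) := by
  simp [augmentation]

/-- Both sides are crossed homomorphisms in w that agree on generators. -/
theorem relBoundary_foxDeriv (w : FreeGroup S) :
    (relBoundary π).hom (foxDeriv π w) =
      MonoidAlgebra.single (π w) 1 - MonoidAlgebra.single 1 1 := by
  have hmul : ∀ a b : FreeGroup S, (relBoundary π).hom (foxDeriv π (a * b)) =
      (relBoundary π).hom (foxDeriv π a) +
        (Rep.leftRegular Zu.{u} G).ρ (π a) ((relBoundary π).hom (foxDeriv π b)) := fun a b => by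
    rw [foxDeriv_mul, map_add, Rep.hom_comm_apply]
  induction w using FreeGroup.induction_on with
  | C1 => simp
  | of x =>
    rw [foxDeriv_of, relBoundary_single, one_mul]
  | inv_of x hx =>
    have h := hmul (FreeGroup.of x)⁻¹ (FreeGroup.of x)
    rw [hx, inv_mul_cancel, foxDeriv_one, map_zero] at h
    rw [eq_neg_of_add_eq_zero_left h.symm]
    simp
  | mul a b ha hb =>
    rw [hmul, ha, hb]
    simp

/-! ### The ℤ-linear splitting -/

/-- A set-theoretic section of `π`. -/
noncomputable def sec (g : G) : FreeGroup S := Function.surjInv hπ g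

@[simp]
theorem map_sec (g : G) : π (sec π hπ g) = g := Function.surjInv_eq hπ g

/-- The deviation of `w` from the chosen representative of its class, as an element of `R_ab`. -/
noncomputable def deviation (w : FreeGroup S) : RAb π :=
  cls π ⟨w * (sec π hπ (π w))⁻¹, by simp [MonoidHom.mem_ker]⟩

/-- Insert s(π a)⁻¹ s(π a) between a and b, with s = `sec`, as in Reidemeister–Schreier rewriting.
-/
theorem deviation_mul (a b : FreeGroup S) :
    deviation π hπ (a * b) = deviation π hπ a + deviation π hπ (sec π hπ (π a) * b) := by
  rw [deviation, deviation, deviation, ← cls_mul]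
  congr 1
  ext1
  simp [mul_assoc]

theorem deviation_sec (g : G) : deviation π hπ (sec π hπ g) = 0 := by
  have h := deviation_mul π hπ (sec π hπ g) 1
  rwa [mul_one, mul_one, map_sec, left_eq_add] at h

/-- The section is not normalised, but s(1) lies in R and commutativity of R_ab cancels it. -/
theorem deviation_sec_one_mul (r : π.ker) : deviation π hπ (sec π hπ 1 * r) = cls π r := by
  have h := deviation_mul π hπ 1 (r : FreeGroup S)
  have h1 : deviation π hπ (r : FreeGroup S) = cls π r + deviation π hπ 1 := by
    rw [deviation, deviation, ← cls_mul]
    congr 1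
    ext1
    simp [(show π (r : FreeGroup S) = 1 from r.2)]
  rw [one_mul, h1, map_one, add_comm] at h
  exact (add_left_cancel h).symm

/-- The retraction `ℤG^(S) → R_ab` of abelian groups. -/
noncomputable def relRetraction : relFree G S →ₗ[Zu.{u}] RAb π :=
  Finsupp.lsum Zu.{u} fun x => (Finsupp.lsum Zu.{u} fun g =>
    LinearMap.toSpanSingleton Zu.{u} (RAb π) (deviation π hπ (sec π hπ g * FreeGroup.of x))) ∘ₗ
      (MonoidAlgebra.coeffLinearEquiv Zu.{u}).toLinearMap

theorem relRetraction_single (x : S) (g : G) :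
    relRetraction π hπ (Finsupp.single x (MonoidAlgebra.single g 1)) =
      deviation π hπ (sec π hπ g * FreeGroup.of x) := by
  simp [relRetraction]

/-- Both sides obey the same product rule in w and agree on generators. Taking g = 1 and w in R
shows that the retraction inverts the embedding. -/
theorem relRetraction_foxDeriv (w : FreeGroup S) (g : G) :
    relRetraction π hπ ((relFree G S).ρ g (foxDeriv π w)) = deviation π hπ (sec π hπ g * w) := by
  have hdev : ∀ (a b : FreeGroup S) (g : G), deviation π hπ (sec π hπ g * (a * b)) =
      deviation π hπ (sec π hπ g * a) + deviation π hπ (sec π hπ (g * π a) * b) := fun a b g => by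
    rw [← mul_assoc, deviation_mul, map_mul, map_sec]
  have hfox : ∀ (a b : FreeGroup S) (g : G),
      relRetraction π hπ ((relFree G S).ρ g (foxDeriv π (a * b))) =
      relRetraction π hπ ((relFree G S).ρ g (foxDeriv π a)) +
        relRetraction π hπ ((relFree G S).ρ (g * π a) (foxDeriv π b)) := fun a b g => by
    rw [foxDeriv_mul, map_add, map_add, map_mul, Module.End.mul_apply]
  induction w using FreeGroup.induction_on generalizing g with
  | C1 => simp [deviation_sec]
  | of x =>
    rw [foxDeriv_of, ← relRetraction_single]
    simp
  | inv_of x hx =>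
    have h := hfox (FreeGroup.of x)⁻¹ (FreeGroup.of x) g
    have h' := hdev (FreeGroup.of x)⁻¹ (FreeGroup.of x) g
    rw [hx, inv_mul_cancel, foxDeriv_one, map_zero, map_zero] at h
    rw [inv_mul_cancel, mul_one, deviation_sec] at h'
    exact add_right_cancel (h.symm.trans h')
  | mul a b ha hb => rw [hfox, hdev, ha, hb]

/-- The `ℤ`-linear map `ℤG → ℤG^(S)` sending `g` to the Fox derivative of its representative. -/
noncomputable def relSection : Rep.leftRegular Zu.{u} G →ₗ[Zu.{u}] relFree G S :=
  (Finsupp.lsum Zu.{u} fun g =>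
    LinearMap.toSpanSingleton Zu.{u} (relFree G S) (foxDeriv π (sec π hπ g))) ∘ₗ
      (MonoidAlgebra.coeffLinearEquiv Zu.{u}).toLinearMap

theorem relSection_single (g : G) :
    relSection π hπ (MonoidAlgebra.single g 1) = foxDeriv π (sec π hπ g) := by
  simp [relSection]

theorem relEmbedding_cls (r : π.ker) :
    (relEmbedding π hπ).hom (cls π r) = foxDeriv π (r : FreeGroup S) := rfl

theorem relEmbedding_deviation (w : FreeGroup S) :
    (relEmbedding π hπ).hom (deviation π hπ w) =
      foxDeriv π w - foxDeriv π (sec π hπ (π w)) := by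
  rw [deviation, relEmbedding_cls, foxDeriv_mul_inv]
  exact (map_sec π hπ _).symm

theorem relRetraction_comp_relEmbedding :
    relRetraction π hπ ∘ₗ (relEmbedding π hπ).hom.toLinearMap = LinearMap.id := by
  refine linearMap_ext_cls π fun r => ?_
  have h := relRetraction_foxDeriv π hπ (r : FreeGroup S) 1
  rw [map_one, Module.End.one_apply, deviation_sec_one_mul] at h
  exact h

/-- On g e_x the first term is D(s(g)) + g e_x - D(s(g π(x))), and the second cancels all but g e_x.
-/
theorem relEmbedding_comp_relRetraction_add :
    (relEmbedding π hπ).hom.toLinearMap ∘ₗ relRetraction π hπ +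
      relSection π hπ ∘ₗ (relBoundary π).hom.toLinearMap = LinearMap.id := by
  refine Finsupp.lhom_ext' fun x => MonoidAlgebra.lhom_ext' fun g => LinearMap.ext_ring ?_
  change (relEmbedding π hπ).hom (relRetraction π hπ (Finsupp.single x (MonoidAlgebra.single g 1)))
    + relSection π hπ ((relBoundary π).hom (Finsupp.single x (MonoidAlgebra.single g 1))) =
    Finsupp.single x (MonoidAlgebra.single g 1)
  rw [relRetraction_single, relBoundary_single, relEmbedding_deviation, map_sub,
    relSection_single, relSection_single, foxDeriv_mul, foxDeriv_of, map_mul, map_sec]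
  have h : (relFree G S).ρ g (basisVec G x) = Finsupp.single x (MonoidAlgebra.single g 1) := by
    simp
  rw [h]
  abel

/-- The `ℤ`-linear section `ℤ → ℤG` of the augmentation. -/
noncomputable def augSection (G : Type u) [Group G] : Zu.{u} →ₗ[Zu.{u}] Rep.leftRegular Zu.{u} G :=
  LinearMap.toSpanSingleton Zu.{u} (Rep.leftRegular Zu.{u} G) (MonoidAlgebra.single 1 1)

theorem augSection_one : augSection G 1 = MonoidAlgebra.single 1 1 :=
  LinearMap.toSpanSingleton_apply_one _ _ _

theorem augmentation_augSection (c : Zu.{u}) : (augmentation G).hom (augSection G c) = c := by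
  have h : (augmentation G).hom.toLinearMap ∘ₗ augSection G = LinearMap.id :=
    LinearMap.ext_ring <| by
      change (augmentation G).hom (augSection G 1) = (1 : Zu.{u})
      rw [augSection_one, augmentation_single]
  exact LinearMap.congr_fun h c

theorem relBoundary_comp_relSection (y : Rep.leftRegular Zu.{u} G)
    (hy : (augmentation G).hom y = (0 : Zu.{u})) :
    (relBoundary π).hom (relSection π hπ y) = y := by
  have h : (relBoundary π).hom.toLinearMap ∘ₗ relSection π hπ =
      LinearMap.id - augSection G ∘ₗ (augmentation G).hom.toLinearMap := by
    refine MonoidAlgebra.lhom_ext' fun g => LinearMap.ext_ring ?_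
    change (relBoundary π).hom (relSection π hπ (MonoidAlgebra.single g 1)) =
      MonoidAlgebra.single g 1 - augSection G ((augmentation G).hom (MonoidAlgebra.single g 1))
    rw [relSection_single, relBoundary_foxDeriv, map_sec, augmentation_single, augSection_one]
  refine (LinearMap.congr_fun h y).trans ?_
  change y - augSection G ((augmentation G).hom y) = y
  rw [hy, map_zero, sub_zero]

theorem augmentation_relBoundary (v : relFree G S) :
    (augmentation G).hom ((relBoundary π).hom v) = (0 : Zu.{u}) := by
  have h : (augmentation G).hom.toLinearMap ∘ₗ (relBoundary π).hom.toLinearMap = 0 := by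
    refine Finsupp.lhom_ext' fun x => MonoidAlgebra.lhom_ext' fun g => LinearMap.ext_ring ?_
    change (augmentation G).hom ((relBoundary π).hom
      (Finsupp.single x (MonoidAlgebra.single g 1))) = (0 : Zu.{u})
    rw [relBoundary_single, map_sub, augmentation_single, augmentation_single, sub_self]
  exact LinearMap.congr_fun h v

theorem relBoundary_relEmbedding (a : RAb π) :
    (relBoundary π).hom ((relEmbedding π hπ).hom a) = 0 := by
  have h : (relBoundary π).hom.toLinearMap ∘ₗ (relEmbedding π hπ).hom.toLinearMap = 0 := by
    refine linearMap_ext_cls π fun r => ?_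
    change (relBoundary π).hom (foxDeriv π (r : FreeGroup S)) = 0
    rw [relBoundary_foxDeriv, r.2, sub_self]
  exact LinearMap.congr_fun h a

/-! ### The two short exact sequences -/

/-- The augmentation ideal, as a representation. -/
noncomputable abbrev augIdeal (G : Type u) [Group G] : Rep.{u} Zu.{u} G :=
  Rep.subrepresentation (Rep.leftRegular Zu.{u} G)
    (LinearMap.ker (augmentation G).hom.toLinearMap) fun g x hx => by
      change (augmentation G).hom ((Rep.leftRegular Zu.{u} G).ρ g x) = 0
      rw [Rep.hom_comm_apply, (show (augmentation G).hom x = 0 from hx), map_zero]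

/-- The `ℤ`-linear retraction `ℤG → I`. -/
noncomputable def augRetraction (G : Type u) [Group G] :
    Rep.leftRegular Zu.{u} G →ₗ[Zu.{u}] augIdeal G :=
  (LinearMap.id - augSection G ∘ₗ (augmentation G).hom.toLinearMap).codRestrict _ fun y => by
    change (augmentation G).hom (y - augSection G ((augmentation G).hom y)) = (0 : Zu.{u})
    rw [map_sub, augmentation_augSection, sub_self]

/-- The short complex `I ⟶ ℤG ⟶ ℤ`. -/
noncomputable def augSequence (G : Type u) [Group G] : ShortComplex (Rep.{u} Zu.{u} G) where
  X₁ := augIdeal G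
  X₂ := Rep.leftRegular Zu.{u} G
  X₃ := 𝟙_ _
  f := Rep.subtype _ _ _
  g := augmentation G
  zero := Rep.hom_ext <| Representation.IntertwiningMap.ext <| LinearMap.ext fun x => x.2

/-- The short complex `R_ab ⟶ ℤG^(S) ⟶ I`. -/
noncomputable def relSequence : ShortComplex (Rep.{u} Zu.{u} G) where
  X₁ := relationModule π hπ
  X₂ := relFree G S
  X₃ := augIdeal G
  f := relEmbedding π hπ
  g := Rep.ofHom
    { toLinearMap := (relBoundary π).hom.toLinearMap.codRestrict _ (augmentation_relBoundary π)
      isIntertwining' := fun g => LinearMap.ext fun v =>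
        Subtype.ext (Rep.hom_comm_apply (relBoundary π) g v) }
  zero := Rep.hom_ext <| Representation.IntertwiningMap.ext <| LinearMap.ext fun x =>
    Subtype.ext (relBoundary_relEmbedding π hπ x)

theorem augSequence_shortExact (M : Rep.{u} Zu.{u} G) :
    ((augSequence G).map (tensorLeft M)).ShortExact := by
  refine groupHomology.shortExact_map_tensorLeft (X := augSequence G) (augRetraction G)
    (augSection G) ?_ ?_ ?_ M
  · refine LinearMap.ext fun (x : augIdeal G) => Subtype.ext ?_
    change x.1 - augSection G ((augmentation G).hom x.1) = x.1
    rw [(show (augmentation G).hom x.1 = (0 : Zu.{u}) from x.2), map_zero, sub_zero]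
  · exact LinearMap.ext augmentation_augSection
  · refine LinearMap.ext fun (y : Rep.leftRegular Zu.{u} G) => ?_
    change y - augSection G ((augmentation G).hom y) + augSection G ((augmentation G).hom y) = y
    rw [sub_add_cancel]

theorem relSequence_shortExact (M : Rep.{u} Zu.{u} G) :
    ((relSequence π hπ).map (tensorLeft M)).ShortExact := by
  refine groupHomology.shortExact_map_tensorLeft (X := relSequence π hπ) (relRetraction π hπ)
    (relSection π hπ ∘ₗ (LinearMap.ker (augmentation G).hom.toLinearMap).subtype) ?_ ?_ ?_ M
  · exact relRetraction_comp_relEmbedding π hπ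
  · exact LinearMap.ext fun x => Subtype.ext (relBoundary_comp_relSection π hπ x.1 x.2)
  · exact relEmbedding_comp_relRetraction_add π hπ

/-! ### The double shift and its iteration -/

/-- `H_{i+2}(G, M) ≅ H_i(G, M ⊗ R_ab)` for `i ≥ 1`, naturally in `M`. -/
noncomputable def relShift (i : ℕ) :
    groupHomology.functor Zu.{u} G (i + 1 + 2) ≅
      tensorRight (relationModule π hπ) ⋙ groupHomology.functor Zu.{u} G (i + 1) :=
  -- M is rewritten as M ⊗ ℤ so that the augmentation sequence applies.
  (Functor.leftUnitor _).symm ≪≫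
    Functor.isoWhiskerRight (rightUnitorNatIso _).symm _ ≪≫
    groupHomology.dimensionShift (X := augSequence G) augSequence_shortExact
      groupHomology.isZero_tensor_leftRegular (i + 1) ≪≫
    groupHomology.dimensionShift (X := relSequence π hπ) (relSequence_shortExact π hπ)
      (fun M n => groupHomology.isZero_tensor_free M S n) i

/-- `H_{i+2k}(G, M) ≅ H_i(G, M ⊗ R_ab^{⊗k})` for `i ≥ 1`, naturally in `M`. -/
theorem nonempty_iterate_relShift (k i : ℕ) :
    Nonempty (groupHomology.functor Zu.{u} G (i + 1 + 2 * k) ≅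
      tensorRight (tensorPow (relationModule π hπ) k) ⋙
        groupHomology.functor Zu.{u} G (i + 1)) := by
  induction k generalizing i with
  | zero =>
    exact ⟨(Functor.leftUnitor _).symm ≪≫ Functor.isoWhiskerRight (rightUnitorNatIso _).symm _⟩
  | succ k ih =>
    -- The first k double shifts stop two degrees higher; the last one is applied with coefficients
    -- M ⊗ R_ab^{⊗k}.
    obtain ⟨e⟩ := ih (i + 2)
    rw [show i + 1 + 2 * (k + 1) = i + 2 + 1 + 2 * k by lia]
    exact ⟨e ≪≫ Functor.isoWhiskerLeft _ (relShift π hπ i) ≪≫ (Functor.associator _ _ _).symm ≪≫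
      Functor.isoWhiskerRight (tensorRightTensor _ _).symm _⟩

end RelationModule

theorem corollary1p2 {G : Type u} [Group G] {S : Type u} (π : FreeGroup S →* G)
    (hπ : Function.Surjective π) (n : ℕ) (hn : 1 ≤ n) :
    Nonempty (groupHomology.functor RelationModule.Zu.{u} G (2 * n) ≅
      tensorRight (RelationModule.tensorPow (RelationModule.relationModule π hπ) (n - 1)) ⋙
        groupHomology.functor RelationModule.Zu.{u} G 2) ∧
    Nonempty (groupHomology.functor RelationModule.Zu.{u} G (2 * n + 1) ≅
      tensorRight (RelationModule.tensorPow (RelationModule.relationModule π hπ) n) ⋙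
        groupHomology.functor RelationModule.Zu.{u} G 1) := by
  obtain ⟨m, rfl⟩ := Nat.exists_eq_add_of_le' hn
  refine ⟨?_, ?_⟩
  -- The final degree is i + 1: i = 1 gives H_2 here, and i = 0 gives H_1 below.
  · rw [show 2 * (m + 1) = 1 + 1 + 2 * m by lia, Nat.add_sub_cancel]
    exact RelationModule.nonempty_iterate_relShift π hπ m 1
  · rw [show 2 * (m + 1) + 1 = 0 + 1 + 2 * (m + 1) by lia]
    exact RelationModule.nonempty_iterate_relShift π hπ (m + 1) 0
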